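/- A permutation $\sigma\in S_n$ is \emph{Baxter} if there are no indices $1\le i<j<k\le n$ with $\sigma(j+1)<\sigma(i)<\sigma(k)<\sigma(j)$ or $\sigma(j)<\sigma(k)<\sigma(i)<\sigma(j+1)$; it is \emph{alternating} if $\sigma(1)<\sigma(2)>\sigma(3)<\sigma(4)>\cdots$. Let $\mathcal{B}_n$ be the set of \emph{doubly alternating Baxter permutations}, i.e. Baxter permutations $\sigma\in S_n$ such that both $\sigma$ and $\sigma^{-1}$ are alternating. \textbf{Theorem.} For every $m\ge 0$ the set $\mathcal{B}_{2m}$ is non-empty. Let $P(m,i,j)$ be the probability that a uniformly random $\sigma\in\mathcal{B}_{2m}$ satisfies $\sigma(i)=j$. Then for all $1\le i,j\le 2m$ $$P(m,i,j)=P(m,j,i)=P(m,2m+1-j,2m+1-i),$$ and the corner probabilities are as follows. (a) As $m\to\infty$, each of $$P(m,1,1),\quad P(m,1,2m-1),\quad P(m,2,2m-1)$$ tends to $\tfrac14$, and so does each of their images under the symmetries above: $$P(m,2m,2m),\quad P(m,2m-1,1),\quad P(m,2,2m),\quad P(m,2m,2),\quad P(m,2m-1,2).$$ In particular, for each of these eight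 positions $(i,j)$ the rescaled probability $m\cdot P(m,i,j)$ tends to $+\infty$ (the corner spikes diverge). (b) For every $m\ge 1$, $$P(m,1,2)=P(m,1,2m)=P(m,2,1)=P(m,2m,1)=P(m,2m-1,2m)=P(m,2m,2m-1)=0,$$ and for every $m\ge 2$, $$P(m,2,2)=P(m,2m-1,2m-1)=0.$$ -/

import Mathlib

open Filter Topology

/-- `σ(1) < σ(2) > σ(3) < σ(4) > ⋯`. Positions are `0`-based in `Fin n`, so the
ascents are at the even positions. -/
def IsAlternating {n : ℕ} (σ : Equiv.Perm (Fin n)) : Prop :=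
  ∀ p q : Fin n, p.val + 1 = q.val →
    (Even p.val → σ p < σ q) ∧ (¬ Even p.val → σ q < σ p)

/-- Baxter permutations: there are no positions `i < j < k` such that
`σ(j+1) < σ(i) < σ(k) < σ(j)` or `σ(j) < σ(k) < σ(i) < σ(j+1)`.
Here `j'` is the position `j + 1`. -/
def IsBaxter {n : ℕ} (σ : Equiv.Perm (Fin n)) : Prop :=
  ∀ i j j' k : Fin n, i < j → j < k → j.val + 1 = j'.val →
    ¬ (σ j' < σ i ∧ σ i < σ k ∧ σ k < σ j) ∧
    ¬ (σ j < σ k ∧ σ k < σ i ∧ σ i < σ j')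

/-- Doubly alternating Baxter permutations: Baxter, with `σ` and `σ⁻¹` both alternating. -/
def IsDoublyAlternatingBaxter {n : ℕ} (σ : Equiv.Perm (Fin n)) : Prop :=
  IsBaxter σ ∧ IsAlternating σ ∧ IsAlternating σ⁻¹

/-- `σ(i) = j` in the usual `1`-based numbering of positions and values
(false unless `1 ≤ i, j ≤ n`). -/
def SendsTo {n : ℕ} (σ : Equiv.Perm (Fin n)) (i j : ℕ) : Prop :=
  ∃ p : Fin n, p.val + 1 = i ∧ (σ p).val + 1 = j

instance {n : ℕ} : DecidablePred (IsAlternating (n := n)) := fun σ => by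
  unfold IsAlternating; infer_instance

instance {n : ℕ} : DecidablePred (IsBaxter (n := n)) := fun σ => by
  unfold IsBaxter; infer_instance

instance {n : ℕ} : DecidablePred (IsDoublyAlternatingBaxter (n := n)) := fun σ => by
  unfold IsDoublyAlternatingBaxter; infer_instance

instance {n : ℕ} (σ : Equiv.Perm (Fin n)) (i j : ℕ) : Decidable (SendsTo σ i j) := by
  unfold SendsTo; infer_instance

/-- The set of doubly alternating Baxter permutations of length `n`. -/
def doublyAlternatingBaxter (n : ℕ) : Finset (Equiv.Perm (Fin n)) :=
  Finset.univ.filter fun σ => IsDoublyAlternatingBaxter σ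

/-- The number of doubly alternating Baxter permutations of length `2m` with `σ(i) = j`. -/
def dabCount (m i j : ℕ) : ℕ :=
  ((doublyAlternatingBaxter (2 * m)).filter fun σ => SendsTo σ i j).card

/-- The probability that a uniformly random doubly alternating Baxter permutation of
length `2m` satisfies `σ(i) = j`. -/
noncomputable def dabProb (m i j : ℕ) : ℝ :=
  (dabCount m i j : ℝ) / ((doublyAlternatingBaxter (2 * m)).card : ℝ)

/-!
The proof finds the recursive structure of doubly alternating Baxter permutations and counts with
it.

First, such a permutation is separable, that is, it avoids `2413` and `3142` altogether
(`BaxterNat.sepOn`). In a minimal occurrence of one of these patterns, the points in the middle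
form a block of even length whose first position and first value have opposite parity. But a
separable block of even length can be cut into two blocks in direct or skew sum, and following the
parities through the cuts shows that its first position and first value have the same parity
(`IsWindow.even_add_of_even`). So the middle is empty, and the Baxter condition is violated. From
here on only separability is used; it is evidently preserved by inversion and reverse-complement,
which gives the two symmetries.

Secondly, every doubly alternating separable permutation of size `2 (m + 1)` is uniquely of the
form `(1 ⊕ τʳ ⊕ 1) ⊖ β`, where `τ` and `β` are such permutations of sizes `2 a` and `2 b` with
`a + b = m` and `τʳ` is `τ` reversed (`IsDab.exists_eq_skewSum_wrapReverse`,
`card_filter_dabNat_succ`).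
The reason is again parity: a separable permutation can be cut according to whether its first value
is below or above its last one, and alternation allows only cuts of this shape. Hence there are
`catalan m` permutations of size `2 m`.

Finally, the first value of `(1 ⊕ τʳ ⊕ 1) ⊖ β` is the size of `β`, and the second one is determined
by the last value of `τ`. So each of the three basic corner events has exactly `catalan (m - 1)`
favourable permutations, and `catalan (m - 1) / catalan m` tends to `1 / 4`. The events of
probability zero are excluded by the parity of the first value and by alternation.

Positions and values are counted from `0`, and permutations of size `n` are treated as permutations
of `ℕ` fixing all numbers from `n` on, so that blocks of different sizes need no casts.
-/

/-! ### Alternation, patterns and windows -/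

/-- The values `σ 0 < σ 1 > σ 2 < ⋯` alternate on the positions below `n`. Parities are written
with `%` so that `omega` can use them. -/
def AltBelow (n : ℕ) (σ : Equiv.Perm ℕ) : Prop :=
  ∀ p, p + 1 < n → (p % 2 = 0 → σ p < σ (p + 1)) ∧ (p % 2 = 1 → σ (p + 1) < σ p)

/-- Alternation of `σ⁻¹` in terms of `σ`: an even value stands to the left of the next value, an
odd value to the right of it. -/
theorem altBelow_inv_iff {n : ℕ} {σ : Equiv.Perm ℕ} :
    AltBelow n σ⁻¹ ↔ ∀ x y, σ y = σ x + 1 → σ y < n →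
      (σ x % 2 = 0 → x < y) ∧ (σ x % 2 = 1 → y < x) := by
  constructor
  · intro h x y hxy hy
    have := h (σ x) (by omega)
    simpa only [← hxy, Equiv.Perm.inv_def, Equiv.symm_apply_apply] using this
  · intro h p hp
    have := h (σ⁻¹ p) (σ⁻¹ (p + 1))
    simp only [Equiv.Perm.inv_def, Equiv.apply_symm_apply] at this
    exact this trivial hp

/-- The positions `i, j, l, k`, meant to be increasing, carry neither the pattern `2413` nor the
pattern `3142`. -/
def AvoidsAt (σ : Equiv.Perm ℕ) (i j l k : ℕ) : Prop :=
  ¬(σ l < σ i ∧ σ i < σ k ∧ σ k < σ j) ∧ ¬(σ j < σ k ∧ σ k < σ i ∧ σ i < σ l)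

/-- The permutation is separable on the positions in `[a, b)`: no occurrence of `2413` or `3142`
lies there. -/
def SepOn (σ : Equiv.Perm ℕ) (a b : ℕ) : Prop :=
  ∀ i j l k, a ≤ i → i < j → j < l → l < k → k < b → AvoidsAt σ i j l k

/-- The permutation maps the `s` positions from `p` on exactly onto the `s` values from `u` on. -/
def IsWindow (σ : Equiv.Perm ℕ) (p u s : ℕ) : Prop :=
  ∀ x, (p ≤ x ∧ x < p + s) ↔ (u ≤ σ x ∧ σ x < u + s)

theorem SepOn.mono {σ : Equiv.Perm ℕ} {a b c d : ℕ} (h : SepOn σ a b) (hc : a ≤ c) (hd : d ≤ b) :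
    SepOn σ c d :=
  fun i j l k h1 h2 h3 h4 h5 => h i j l k (by omega) h2 h3 h4 (by omega)

/-- If a block of `t` consecutive positions of a window carries smaller values than all other
positions of the window, these values are the `t` lowest ones. -/
theorem IsWindow.of_lower {σ : Equiv.Perm ℕ} {p u s a t : ℕ} (h : IsWindow σ p u s)
    (ha : p ≤ a) (hat : a + t ≤ p + s)
    (hlt : ∀ x y, a ≤ x → x < a + t → p ≤ y → y < p + s → ¬(a ≤ y ∧ y < a + t) → σ x < σ y) :
    IsWindow σ a u t := by
  have hcard : ((Finset.Ico a (a + t)).image σ).card = t := by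
    rw [Finset.card_image_of_injective _ σ.injective, Nat.card_Ico]; omega
  have h1 : ∀ x, a ≤ x → x < a + t → σ x < u + t := by
    intro x hx hx'
    have hsub : Finset.Ico u (σ x + 1) ⊆ (Finset.Ico a (a + t)).image σ := by
      intro w hw
      rw [Finset.mem_Ico] at hw
      have hxw := (h x).1 (by omega)
      have hy := (h (σ.symm w)).2 (by rw [Equiv.apply_symm_apply]; omega)
      rw [Finset.mem_image]
      refine ⟨σ.symm w, ?_, σ.apply_symm_apply w⟩
      rw [Finset.mem_Ico]
      by_contra hn
      have := hlt x (σ.symm w) hx hx' hy.1 hy.2 hn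
      rw [Equiv.apply_symm_apply] at this
      omega
    have := Finset.card_le_card hsub
    rw [hcard, Nat.card_Ico] at this
    omega
  intro y
  constructor
  · intro hy
    exact ⟨((h y).1 (by omega)).1, h1 y hy.1 hy.2⟩
  · intro hy
    by_contra hn
    have hyw := (h y).2 (by omega)
    have hsub : (Finset.Ico a (a + t)).image σ ⊆ Finset.Ico u (σ y) := by
      intro w hw
      obtain ⟨x, hx, rfl⟩ := Finset.mem_image.1 hw
      rw [Finset.mem_Ico] at hx ⊢
      exact ⟨((h x).1 (by omega)).1, hlt x y hx.1 hx.2 hyw.1 hyw.2 hn⟩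
    have := Finset.card_le_card hsub
    rw [hcard, Nat.card_Ico] at this
    omega

theorem Nat.exists_last {P : ℕ → Prop} {a b : ℕ} (hab : a ≤ b) (ha : P a) :
    ∃ r, a ≤ r ∧ r ≤ b ∧ P r ∧ ∀ y, r < y → y ≤ b → ¬P y := by
  classical
  exact ⟨Nat.findGreatest P b, Nat.le_findGreatest hab ha, Nat.findGreatest_le b,
    Nat.findGreatest_spec hab ha, fun y h1 h2 => Nat.findGreatest_is_greatest h1 h2⟩

/-! ### Cutting separable windows -/

/-- In a separable window whose first value is below its last one, everything after the last
position `q = p + r - 1` with `σ q ≤ σ p` lies above everything up to `q`, so the window is a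
direct sum. Indeed, if `x < q < y` violated this, the positions `p, x, q, y` would carry `2413`. -/
theorem IsWindow.split_up {σ : Equiv.Perm ℕ} {p u s : ℕ} (h : IsWindow σ p u s) (hs : 0 < s)
    (hsep : SepOn σ p (p + s)) (hlt : σ p < σ (p + s - 1)) :
    ∃ r, 0 < r ∧ r < s ∧ σ (p + r - 1) ≤ σ p ∧
      IsWindow σ p u r ∧ IsWindow σ (p + r) (u + r) (s - r) := by
  obtain ⟨q, hpq, hqs, hq, hlast⟩ :=
    Nat.exists_last (P := fun x => σ x ≤ σ p) (a := p) (b := p + s - 1) (by omega) le_rfl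
  have hne : q ≠ p + s - 1 := by rintro rfl; omega
  have hw : IsWindow σ p u (q + 1 - p) := by
    refine h.of_lower le_rfl (by omega) fun x y hx hx' hy hy' hn => ?_
    have h1 := hlast y (by omega) (by omega)
    by_contra hxy
    have hxp : x ≠ p := by rintro rfl; omega
    have hxq : x ≠ q := by rintro rfl; omega
    have hqp : q ≠ p := by omega
    have h2 := σ.injective.ne hqp
    have h3 : σ x ≠ σ y := σ.injective.ne (by omega)
    exact (hsep p x q y le_rfl (by omega) (by omega) (by omega) hy').1 (by omega)
  refine ⟨q + 1 - p, by omega, by omega, ?_, hw, fun x => ?_⟩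
  · rwa [show p + (q + 1 - p) - 1 = q by omega]
  · have h1 := h x
    have h2 := hw x
    omega

/-- The mirror image of `IsWindow.split_up`, where `3142` is the forbidden pattern. -/
theorem IsWindow.split_down {σ : Equiv.Perm ℕ} {p u s : ℕ} (h : IsWindow σ p u s) (hs : 0 < s)
    (hsep : SepOn σ p (p + s)) (hlt : σ (p + s - 1) < σ p) :
    ∃ r, 0 < r ∧ r < s ∧ σ p ≤ σ (p + r - 1) ∧
      IsWindow σ p (u + (s - r)) r ∧ IsWindow σ (p + r) u (s - r) := by
  obtain ⟨q, hpq, hqs, hq, hlast⟩ :=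
    Nat.exists_last (P := fun x => σ p ≤ σ x) (a := p) (b := p + s - 1) (by omega) le_rfl
  have hne : q ≠ p + s - 1 := by rintro rfl; omega
  have hw : IsWindow σ (q + 1) u (p + s - (q + 1)) := by
    refine h.of_lower (by omega) (by omega) fun x y hx hx' hy hy' hn => ?_
    have h1 := hlast x (by omega) (by omega)
    by_contra hxy
    have hyp : y ≠ p := by rintro rfl; omega
    have hyq : y ≠ q := by rintro rfl; omega
    have hqp : q ≠ p := by omega
    have h2 := σ.injective.ne hqp
    have h3 : σ x ≠ σ y := σ.injective.ne (by omega)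
    exact (hsep p y q x le_rfl (by omega) (by omega) (by omega) (by omega)).2 (by omega)
  refine ⟨q + 1 - p, by omega, by omega, ?_, fun x => ?_, ?_⟩
  · rwa [show p + (q + 1 - p) - 1 = q by omega]
  · have h1 := h x
    have h2 := hw x
    omega
  · rwa [show p + (q + 1 - p) = q + 1 by omega, show s - (q + 1 - p) = p + s - (q + 1) by omega]

theorem IsWindow.exists_pos {σ : Equiv.Perm ℕ} {p u s w : ℕ} (h : IsWindow σ p u s)
    (h1 : u ≤ w) (h2 : w < u + s) : ∃ x, σ x = w ∧ p ≤ x ∧ x < p + s := by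
  refine ⟨σ.symm w, σ.apply_symm_apply w, ?_⟩
  rw [h, σ.apply_symm_apply]
  exact ⟨h1, h2⟩

/-- In a doubly alternating permutation, a nonempty separable window of even length starts at a
position and at a value of the same parity. Split the window in two: if the parts are even, the
claim follows by induction; if they are odd, then the boundary between them is simultaneously an
ascent or descent in position and in value, which gives both parities. -/
theorem IsWindow.even_add_of_even {n : ℕ} {σ : Equiv.Perm ℕ} (hσ : AltBelow n σ)
    (hσ' : AltBelow n σ⁻¹) (s : ℕ) : ∀ p u, IsWindow σ p u s → 0 < s → s % 2 = 0 →
      p + s ≤ n → u + s ≤ n → SepOn σ p (p + s) → (p + u) % 2 = 0 := by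
  rw [altBelow_inv_iff] at hσ'
  induction s using Nat.strong_induction_on with
  | _ s ih =>
    intro p u h hs hs2 hp hu hsep
    have hne : σ p ≠ σ (p + s - 1) := σ.injective.ne (by omega)
    rcases lt_or_gt_of_ne hne with hlt | hlt
    · obtain ⟨r, hr0, hrs, -, h1, h2⟩ := h.split_up hs hsep hlt
      by_cases hr : r % 2 = 0
      · exact ih r hrs p u h1 hr0 hr (by omega) (by omega) (hsep.mono le_rfl (by omega))
      -- An odd cut is an ascent both in position and in value.
      · have ha := (h1 (p + r - 1)).1 (by omega)
        have hb := (h2 (p + r)).1 (by omega)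
        have hA := hσ (p + r - 1) (by omega)
        rw [show p + r - 1 + 1 = p + r by omega] at hA
        obtain ⟨x, hx, hx1, hx2⟩ := h1.exists_pos (w := u + r - 1) (by omega) (by omega)
        obtain ⟨y, hy, hy1, hy2⟩ := h2.exists_pos (w := u + r) (by omega) (by omega)
        have hV := hσ' x y (by omega) (by omega)
        omega
    · obtain ⟨r, hr0, hrs, -, h1, h2⟩ := h.split_down hs hsep hlt
      by_cases hr : r % 2 = 0
      · have := ih r hrs p _ h1 hr0 hr (by omega) (by omega) (hsep.mono le_rfl (by omega))
        omega
      -- An odd cut is a descent both in position and in value.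
      · have ha := (h1 (p + r - 1)).1 (by omega)
        have hb := (h2 (p + r)).1 (by omega)
        have hA := hσ (p + r - 1) (by omega)
        rw [show p + r - 1 + 1 = p + r by omega] at hA
        obtain ⟨x, hx, hx1, hx2⟩ := h2.exists_pos (w := u + (s - r) - 1) (by omega) (by omega)
        obtain ⟨y, hy, hy1, hy2⟩ := h1.exists_pos (w := u + (s - r)) (by omega) (by omega)
        have hV := hσ' x y (by omega) (by omega)
        omega

/-! ### Doubly alternating Baxter permutations are separable -/

/-- The permutation fixes all `x ≥ n`; such permutations of `ℕ` stand for those of `Fin n`. -/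
def SuppBelow (n : ℕ) (σ : Equiv.Perm ℕ) : Prop := ∀ x, n ≤ x → σ x = x

theorem SuppBelow.apply_lt_iff {n : ℕ} {σ : Equiv.Perm ℕ} (h : SuppBelow n σ) {x : ℕ} :
    σ x < n ↔ x < n := by
  constructor
  · intro hx
    by_contra hn
    have := h x (by omega)
    omega
  · intro hx
    by_contra hn
    have := σ.injective (h (σ x) (by omega))
    omega

theorem SuppBelow.isWindow {n : ℕ} {σ : Equiv.Perm ℕ} (h : SuppBelow n σ) : IsWindow σ 0 0 n := by
  intro x
  have := h.apply_lt_iff (x := x)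
  omega

theorem SuppBelow.inv {n : ℕ} {σ : Equiv.Perm ℕ} (h : SuppBelow n σ) : SuppBelow n σ⁻¹ := by
  intro x hx
  rw [Equiv.Perm.inv_eq_iff_eq, h x hx]

/-- If the positions strictly between `j` and `l` are exactly those with values strictly between `b`
and `c`, they form a window. -/
theorem window_of_minimal {σ : Equiv.Perm ℕ} {j l b c : ℕ} (hjl : j < l) (hbc : b < c)
    (h1 : ∀ x, j < x → x < l → b < σ x ∧ σ x < c)
    (h2 : ∀ x, b < σ x → σ x < c → j < x ∧ x < l) :
    IsWindow σ (j + 1) (b + 1) (l - j - 1) ∧ l - j = c - b := by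
  have hcard : l - j = c - b := by
    have : (Finset.Ioo j l).image σ = Finset.Ioo b c := by
      ext w
      simp only [Finset.mem_image, Finset.mem_Ioo]
      constructor
      · rintro ⟨x, hx, rfl⟩
        exact h1 x hx.1 hx.2
      · intro hw
        exact ⟨σ.symm w, h2 _ (by simpa using hw.1) (by simpa using hw.2), by simp⟩
    have h3 := congrArg Finset.card this
    rw [Finset.card_image_of_injective _ σ.injective, Nat.card_Ioo, Nat.card_Ioo] at h3
    omega
  refine ⟨fun x => ?_, hcard⟩
  have := h1 x
  have := h2 x
  omega

/-- The Baxter condition: in an occurrence of `2413` or `3142`, the two middle positions are not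
adjacent. -/
def BaxterNat (σ : Equiv.Perm ℕ) : Prop :=
  ∀ i j k, i < j → j + 1 < k → AvoidsAt σ i j (j + 1) k

/-- A doubly alternating Baxter permutation is separable. Take an occurrence of `2413` or `3142`
with minimal distance of its middle positions and, among these, minimal difference of its two
middle values. By minimality the positions between the middle two are those with values between the
middle two, so they form a separable window. Alternation makes the length of this window even and
its first position and first value of opposite parity, so the window is empty by
`IsWindow.even_add_of_even`; the middle positions are then adjacent, against the Baxter condition.
-/
theorem BaxterNat.sepOn {n : ℕ} {σ : Equiv.Perm ℕ} (hB : BaxterNat σ) (hn : SuppBelow n σ)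
    (hσ : AltBelow n σ) (hσ' : AltBelow n σ⁻¹) : SepOn σ 0 n := by
  have key : ∀ d i j l k, i < j → j < l → l < k → k < n → l - j ≤ d → AvoidsAt σ i j l k := by
    intro d
    induction d with
    | zero => intro i j l k _ _ _ _ _; omega
    | succ d ihd =>
      -- For a given distance of the middle positions, induct on the difference of the middle
      -- values.
      have key' : ∀ e i j l k, i < j → j < l → l < k → k < n → l - j ≤ d + 1 →
          (σ k - σ i) + (σ i - σ k) ≤ e → AvoidsAt σ i j l k := by
        intro e
        induction e with
        | zero =>
          intro i j l k hij hjl hlk _ _ he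
          have : σ k ≠ σ i := σ.injective.ne (by omega)
          omega
        | succ e ihe =>
          intro i j l k hij hjl hlk hk hd he
          have hsep : SepOn σ (j + 1) l := fun i' j' l' k' g1 g2 g3 g4 g5 =>
            ihd i' j' l' k' g2 g3 g4 (by omega) (by omega)
          have hV := altBelow_inv_iff.1 hσ'
          have hkn := hn.apply_lt_iff.2 hk
          have hjn := hn.apply_lt_iff.2 (show j < n by omega)
          have hin := hn.apply_lt_iff.2 (show i < n by omega)
          have hln := hn.apply_lt_iff.2 (show l < n by omega)
          constructor
          · rintro ⟨c1, c2, c3⟩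
            obtain ⟨hw, hlen⟩ := window_of_minimal (σ := σ) hjl c2 (fun x hx1 hx2 => by
              have n1 : σ x ≠ σ i := σ.injective.ne (by omega)
              have n2 : σ x ≠ σ k := σ.injective.ne (by omega)
              have a1 := (ihd i x l k (by omega) hx2 hlk hk (by omega)).1
              have a2 := (ihd i j x k hij hx1 (by omega) hk (by omega)).1
              omega) (fun x hx1 hx2 => by
              have n1 : x ≠ j := by rintro rfl; omega
              have n2 : x ≠ l := by rintro rfl; omega
              by_contra hx
              rcases (show x < j ∨ l < x by omega) with hx | hx
              · exact (ihe x j l k hx hjl hlk hk hd (by omega)).1 (by omega)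
              · have hxn := hn.apply_lt_iff.1 (show σ x < n by omega)
                exact (ihe i j l x hij hjl hx hxn hd (by omega)).1 (by omega))
            rcases Nat.eq_or_lt_of_le (show j + 1 ≤ l by omega) with hl | hl
            · subst hl
              exact (hB i j k hij hlk).1 ⟨c1, c2, c3⟩
            · have w1 := (hw (j + 1)).1 (by omega)
              have w2 := (hw (l - 1)).1 (by omega)
              have p1 := hσ j (by omega)
              have p2 := hσ (l - 1) (by omega)
              rw [show l - 1 + 1 = l by omega] at p2
              obtain ⟨x, hx, hx1, hx2⟩ := hw.exists_pos (w := σ i + 1) (by omega) (by omega)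
              have v1 := hV i x hx (by omega)
              have := hw.even_add_of_even hσ hσ' _ _ _ (by omega) (by omega) (by omega) (by omega)
                (hsep.mono le_rfl (by omega))
              omega
          · rintro ⟨c1, c2, c3⟩
            obtain ⟨hw, hlen⟩ := window_of_minimal (σ := σ) hjl c2 (fun x hx1 hx2 => by
              have n1 : σ x ≠ σ i := σ.injective.ne (by omega)
              have n2 : σ x ≠ σ k := σ.injective.ne (by omega)
              have a1 := (ihd i x l k (by omega) hx2 hlk hk (by omega)).2
              have a2 := (ihd i j x k hij hx1 (by omega) hk (by omega)).2
              omega) (fun x hx1 hx2 => by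
              have n1 : x ≠ j := by rintro rfl; omega
              have n2 : x ≠ l := by rintro rfl; omega
              by_contra hx
              rcases (show x < j ∨ l < x by omega) with hx | hx
              · exact (ihe x j l k hx hjl hlk hk hd (by omega)).2 (by omega)
              · have hxn := hn.apply_lt_iff.1 (show σ x < n by omega)
                exact (ihe i j l x hij hjl hx hxn hd (by omega)).2 (by omega))
            rcases Nat.eq_or_lt_of_le (show j + 1 ≤ l by omega) with hl | hl
            · subst hl
              exact (hB i j k hij hlk).2 ⟨c1, c2, c3⟩
            · have w1 := (hw (j + 1)).1 (by omega)
              have w2 := (hw (l - 1)).1 (by omega)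
              have p1 := hσ j (by omega)
              have p2 := hσ (l - 1) (by omega)
              rw [show l - 1 + 1 = l by omega] at p2
              obtain ⟨x, hx, hx1, hx2⟩ := hw.exists_pos (w := σ k + 1) (by omega) (by omega)
              have v1 := hV k x hx (by omega)
              have := hw.even_add_of_even hσ hσ' _ _ _ (by omega) (by omega) (by omega) (by omega)
                (hsep.mono le_rfl (by omega))
              omega
      exact fun i j l k h1 h2 h3 h4 h5 => key' _ i j l k h1 h2 h3 h4 h5 le_rfl
  exact fun i j l k _ h2 h3 h4 h5 => key _ i j l k h2 h3 h4 h5 le_rfl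

/-! ### Symmetries of doubly alternating separable permutations -/

/-- Doubly alternating separable permutations of size `n`, as permutations of `ℕ` fixing all
`x ≥ n`. By `isDab_extendNat_iff` these are the doubly alternating Baxter permutations. -/
structure IsDab (n : ℕ) (σ : Equiv.Perm ℕ) : Prop where
  supp : SuppBelow n σ
  alt : AltBelow n σ
  alt_inv : AltBelow n σ⁻¹
  sep : SepOn σ 0 n

theorem isDab_zero {σ : Equiv.Perm ℕ} (h : SuppBelow 0 σ) : IsDab 0 σ :=
  ⟨h, fun p hp => by omega, fun p hp => by omega, fun i j l k _ _ _ _ _ => by omega⟩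

/-- Inversion exchanges the patterns `2413` and `3142`. -/
theorem IsDab.inv {n : ℕ} {σ : Equiv.Perm ℕ} (h : IsDab n σ) : IsDab n σ⁻¹ := by
  refine ⟨h.supp.inv, h.alt_inv, by rw [inv_inv]; exact h.alt, fun i j l k h1 h2 h3 h4 h5 => ?_⟩
  have hs := h.sep
  obtain ⟨I, rfl⟩ := σ.surjective i
  obtain ⟨J, rfl⟩ := σ.surjective j
  obtain ⟨L, rfl⟩ := σ.surjective l
  obtain ⟨K, rfl⟩ := σ.surjective k
  have bI := h.supp.apply_lt_iff (x := I)
  have bJ := h.supp.apply_lt_iff (x := J)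
  have bL := h.supp.apply_lt_iff (x := L)
  have bK := h.supp.apply_lt_iff (x := K)
  simp only [AvoidsAt, Equiv.Perm.inv_def, Equiv.symm_apply_apply]
  constructor
  · rintro ⟨c1, c2, c3⟩
    exact (hs L I K J (by omega) c1 c2 c3 (by omega)).2 ⟨h2, h3, h4⟩
  · rintro ⟨c1, c2, c3⟩
    exact (hs J K I L (by omega) c1 c2 c3 (by omega)).1 ⟨h2, h3, h4⟩

/-- The reversal `x ↦ n - 1 - x` of `[0, n)`, extended by the identity. -/
def revBelow (n : ℕ) : Equiv.Perm ℕ where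
  toFun x := if x < n then n - 1 - x else x
  invFun x := if x < n then n - 1 - x else x
  left_inv x := by dsimp only; split_ifs <;> omega
  right_inv x := by dsimp only; split_ifs <;> omega

theorem revBelow_apply (n x : ℕ) : revBelow n x = if x < n then n - 1 - x else x := rfl

theorem revBelow_inv (n : ℕ) : (revBelow n)⁻¹ = revBelow n := rfl

theorem revBelow_mul_self (n : ℕ) : revBelow n * revBelow n = 1 := by
  rw [mul_eq_one_iff_inv_eq, revBelow_inv]

/-- The reverse-complement of a permutation of size `n`, reflecting positions and values. -/
def revComp (n : ℕ) (σ : Equiv.Perm ℕ) : Equiv.Perm ℕ := revBelow n * σ * revBelow n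

theorem revComp_revComp (n : ℕ) (σ : Equiv.Perm ℕ) : revComp n (revComp n σ) = σ := by
  simp only [revComp]
  rw [← mul_assoc, ← mul_assoc, revBelow_mul_self, one_mul, mul_assoc, revBelow_mul_self, mul_one]

theorem revComp_inv (n : ℕ) (σ : Equiv.Perm ℕ) : (revComp n σ)⁻¹ = revComp n σ⁻¹ := by
  simp only [revComp, mul_inv_rev, revBelow_inv, mul_assoc]

theorem revComp_apply {n : ℕ} {σ : Equiv.Perm ℕ} (h : SuppBelow n σ) {x : ℕ} (hx : x < n) :
    revComp n σ x = n - 1 - σ (n - 1 - x) := by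
  have := h.apply_lt_iff.2 (show n - 1 - x < n by omega)
  simp only [revComp, Equiv.Perm.mul_apply, revBelow_apply, if_pos hx, if_pos this]

theorem SuppBelow.revComp {n : ℕ} {σ : Equiv.Perm ℕ} (h : SuppBelow n σ) :
    SuppBelow n (revComp n σ) := by
  intro x hx
  have h1 := h x hx
  simp only [_root_.revComp, Equiv.Perm.mul_apply, revBelow_apply, if_neg (not_lt.2 hx), h1]

theorem AltBelow.revComp {n : ℕ} {σ : Equiv.Perm ℕ} (hn : n % 2 = 0) (h : SuppBelow n σ)
    (ha : AltBelow n σ) : AltBelow n (revComp n σ) := by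
  intro p hp
  rw [revComp_apply h (by omega : p < n), revComp_apply h hp]
  have := h.apply_lt_iff.2 (show n - 1 - p < n by omega)
  have := h.apply_lt_iff.2 (show n - 1 - (p + 1) < n by omega)
  have := ha (n - 1 - (p + 1)) (by omega)
  rw [show n - 1 - (p + 1) + 1 = n - 1 - p by omega] at this
  omega

theorem IsDab.revComp {n : ℕ} {σ : Equiv.Perm ℕ} (hn : n % 2 = 0) (h : IsDab n σ) :
    IsDab n (revComp n σ) := by
  refine ⟨h.supp.revComp, h.alt.revComp hn h.supp, ?_, fun i j l k h1 h2 h3 h4 h5 => ?_⟩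
  · rw [revComp_inv]
    exact h.alt_inv.revComp hn h.supp.inv
  · have := h.sep (n - 1 - k) (n - 1 - l) (n - 1 - j) (n - 1 - i) (by omega) (by omega) (by omega)
      (by omega) (by omega)
    have b1 := h.supp.apply_lt_iff.2 (show n - 1 - k < n by omega)
    have b2 := h.supp.apply_lt_iff.2 (show n - 1 - l < n by omega)
    have b3 := h.supp.apply_lt_iff.2 (show n - 1 - j < n by omega)
    have b4 := h.supp.apply_lt_iff.2 (show n - 1 - i < n by omega)
    unfold AvoidsAt at this ⊢
    rw [revComp_apply h.supp (by omega : i < n), revComp_apply h.supp (by omega : j < n),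
      revComp_apply h.supp (by omega : l < n), revComp_apply h.supp (by omega : k < n)]
    omega

/-! ### Skew sums -/

/-- The permutation moving the block `[0, p)` behind the block `[p, p + q)`. -/
def blockSwap (p q : ℕ) : Equiv.Perm ℕ where
  toFun x := if x < p then x + q else if x < p + q then x - p else x
  invFun x := if x < q then x + p else if x < p + q then x - q else x
  left_inv x := by dsimp only; split_ifs <;> omega
  right_inv x := by dsimp only; split_ifs <;> omega

theorem blockSwap_apply (p q x : ℕ) :
    blockSwap p q x = if x < p then x + q else if x < p + q then x - p else x := rfl

/-- The skew sum of `α` of size `p` and `β` of size `q`: the positions `[0, p)` carry a copy of `α`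
on the values `[q, p + q)`, and the next `q` positions carry `β`. It has this meaning only if `α`
and `β` fix all numbers from `p` and `q` on; as a product of permutations it is defined for all
`α` and `β`. -/
noncomputable def skewSum (p q : ℕ) (α β : Equiv.Perm ℕ) : Equiv.Perm ℕ :=
  blockSwap p q * (α * β.viaEmbedding (addRightEmbedding p))

section skewSum
variable {p q : ℕ} {α β : Equiv.Perm ℕ}

theorem viaEmbedding_addRight_apply (β : Equiv.Perm ℕ) (p x : ℕ) :
    β.viaEmbedding (addRightEmbedding p) x = if x < p then x else β (x - p) + p := by
  split_ifs with h
  · refine Equiv.Perm.viaEmbedding_apply_of_notMem _ _ _ ?_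
    rintro ⟨y, hy⟩
    simp only [addRightEmbedding_apply] at hy
    omega
  · obtain ⟨y, rfl⟩ : ∃ y, x = y + p := ⟨x - p, by omega⟩
    have := β.viaEmbedding_apply (addRightEmbedding p) y
    simp only [addRightEmbedding_apply] at this
    rw [this, Nat.add_sub_cancel]

theorem skewSum_apply_of_lt (hα : SuppBelow p α) {x : ℕ} (hx : x < p) :
    skewSum p q α β x = α x + q := by
  have := hα.apply_lt_iff.2 hx
  simp only [skewSum, Equiv.Perm.mul_apply, viaEmbedding_addRight_apply, if_pos hx,
    blockSwap_apply, if_pos this]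

theorem skewSum_apply_of_le (hα : SuppBelow p α) (hβ : SuppBelow q β) {x : ℕ} (hx : p ≤ x)
    (hx' : x < p + q) : skewSum p q α β x = β (x - p) := by
  have := hβ.apply_lt_iff.2 (show x - p < q by omega)
  simp only [skewSum, Equiv.Perm.mul_apply, viaEmbedding_addRight_apply, if_neg (not_lt.2 hx)]
  rw [hα _ (by omega), blockSwap_apply, if_neg (by omega), if_pos (by omega)]
  omega

theorem suppBelow_skewSum (hα : SuppBelow p α) (hβ : SuppBelow q β) :
    SuppBelow (p + q) (skewSum p q α β) := by
  intro x hx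
  simp only [skewSum, Equiv.Perm.mul_apply, viaEmbedding_addRight_apply]
  rw [if_neg (by omega), hβ _ (by omega), hα _ (by omega), blockSwap_apply, if_neg (by omega),
    if_neg (by omega)]
  omega

theorem skewSum_cases (hα : SuppBelow p α) (hβ : SuppBelow q β) {x : ℕ} (hx : x < p + q) :
    (x < p ∧ skewSum p q α β x = α x + q ∧ α x < p) ∨
      (p ≤ x ∧ skewSum p q α β x = β (x - p) ∧ β (x - p) < q) := by
  by_cases h : x < p
  · exact Or.inl ⟨h, skewSum_apply_of_lt hα h, hα.apply_lt_iff.2 h⟩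
  · exact Or.inr ⟨by omega, skewSum_apply_of_le hα hβ (by omega) hx,
      hβ.apply_lt_iff.2 (by omega)⟩

theorem isDab_skewSum (hp : p % 2 = 0) (hq : q % 2 = 0) (hα : IsDab p α) (hβ : IsDab q β) :
    IsDab (p + q) (skewSum p q α β) := by
  have hS := suppBelow_skewSum hα.supp hβ.supp
  refine ⟨hS, fun x hx => ?_, altBelow_inv_iff.2 fun x y hxy hy => ?_,
    fun i j l k _ h2 h3 h4 h5 => ?_⟩
  · have hA := hα.alt x
    have hB := hβ.alt (x - p)
    have c1 := skewSum_cases hα.supp hβ.supp (show x < p + q by omega)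
    rcases skewSum_cases hα.supp hβ.supp hx with ⟨d1, d2, d3⟩ | ⟨d1, d2, d3⟩
    · omega
    · rcases c1 with ⟨e1, e2, e3⟩ | ⟨e1, e2, e3⟩
      · omega
      · rw [show x - p + 1 = x + 1 - p by omega] at hB
        omega
  · have hx' := hS.apply_lt_iff.1 (show skewSum p q α β x < p + q by omega)
    have hy' := hS.apply_lt_iff.1 hy
    have hA := altBelow_inv_iff.1 hα.alt_inv x y
    have hB := altBelow_inv_iff.1 hβ.alt_inv (x - p) (y - p)
    rcases skewSum_cases hα.supp hβ.supp hx' with ⟨d1, d2, d3⟩ | ⟨d1, d2, d3⟩ <;>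
    rcases skewSum_cases hα.supp hβ.supp hy' with ⟨e1, e2, e3⟩ | ⟨e1, e2, e3⟩ <;>
    omega
  · have hA := hα.sep i j l k
    have hB := hβ.sep (i - p) (j - p) (l - p) (k - p)
    unfold AvoidsAt at hA hB ⊢
    rcases skewSum_cases hα.supp hβ.supp (show i < p + q by omega) with
      ⟨a1, a2, a3⟩ | ⟨a1, a2, a3⟩ <;>
    rcases skewSum_cases hα.supp hβ.supp (show k < p + q by omega) with
      ⟨d1, d2, d3⟩ | ⟨d1, d2, d3⟩
    · rw [skewSum_apply_of_lt hα.supp (show j < p by omega),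
        skewSum_apply_of_lt hα.supp (show l < p by omega)]
      omega
    · rcases skewSum_cases hα.supp hβ.supp (show j < p + q by omega) with
        ⟨b1, b2, b3⟩ | ⟨b1, b2, b3⟩ <;>
      rcases skewSum_cases hα.supp hβ.supp (show l < p + q by omega) with
        ⟨c1, c2, c3⟩ | ⟨c1, c2, c3⟩ <;>
      omega
    · omega
    · rw [skewSum_apply_of_le hα.supp hβ.supp (show p ≤ j by omega) (by omega),
        skewSum_apply_of_le hα.supp hβ.supp (show p ≤ l by omega) (by omega)]
      omega

theorem skewSum_inj {α' β' : Equiv.Perm ℕ} (hα : SuppBelow p α) (hβ : SuppBelow q β)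
    (hα' : SuppBelow p α') (hβ' : SuppBelow q β')
    (h : skewSum p q α β = skewSum p q α' β') : α = α' ∧ β = β' := by
  constructor <;> ext x
  · rcases lt_or_ge x p with hx | hx
    · have := congrArg (· x) h
      simp only [skewSum_apply_of_lt hα hx, skewSum_apply_of_lt hα' hx] at this
      omega
    · rw [hα x hx, hα' x hx]
  · rcases lt_or_ge x q with hx | hx
    · have := congrArg (· (x + p)) h
      simp only [skewSum_apply_of_le hα hβ (show p ≤ x + p by omega) (by omega),
        skewSum_apply_of_le hα' hβ' (show p ≤ x + p by omega) (by omega),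
        Nat.add_sub_cancel] at this
      exact this
    · rw [hβ x hx, hβ' x hx]

end skewSum

/-- An injection of `[0, n)` into itself is the restriction of a permutation fixing all `x ≥ n`. -/
theorem exists_perm_eq_below {n : ℕ} (f : ℕ → ℕ) (hf : ∀ x < n, f x < n)
    (hinj : ∀ x < n, ∀ y < n, f x = f y → x = y) :
    ∃ σ : Equiv.Perm ℕ, SuppBelow n σ ∧ ∀ x < n, σ x = f x := by
  have hsurj : Set.SurjOn f (Finset.range n) (Finset.range n) := by
    apply Finset.surjOn_of_injOn_of_card_le
    · intro x hx
      simpa using hf x (by simpa using hx)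
    · intro x hx y hy hxy
      exact hinj x (by simpa using hx) y (by simpa using hy) hxy
    · rfl
  let g : ℕ → ℕ := fun x => if x < n then f x else x
  have hg : Function.Bijective g := by
    constructor
    · intro x y hxy
      have h1 := hf x
      have h2 := hf y
      have h3 := hinj x
      have h4 := fun hx hy => h3 hx y hy
      simp only [g] at hxy
      split_ifs at hxy with hx hy hy
      · exact h4 hx hy hxy
      · have := h1 hx
        omega
      · have := h2 hy
        omega
      · exact hxy
    · intro y
      rcases lt_or_ge y n with hy | hy
      · obtain ⟨x, hx, rfl⟩ := hsurj (show y ∈ (Finset.range n : Set ℕ) by simpa using hy)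
        exact ⟨x, if_pos (by simpa using hx)⟩
      · exact ⟨y, if_neg (by omega)⟩
  exact ⟨Equiv.ofBijective g hg, fun x hx => if_neg (by omega), fun x hx => if_pos hx⟩

/-- If the first `p` positions of a doubly alternating separable permutation carry its `p` highest
values, it is a skew sum. -/
theorem IsDab.exists_skewSum {p q : ℕ} {σ : Equiv.Perm ℕ} (hp : p % 2 = 0) (hq : q % 2 = 0)
    (h : IsDab (p + q) σ) (hw : IsWindow σ 0 q p) :
    ∃ α β, IsDab p α ∧ IsDab q β ∧ σ = skewSum p q α β := by
  have hA : ∀ x < p, q ≤ σ x ∧ σ x < q + p := fun x hx => (hw x).1 (by omega)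
  have hB : ∀ x < q, σ (x + p) < q := fun x hx => by
    have := hw (x + p)
    have := h.supp.apply_lt_iff.2 (show x + p < p + q by omega)
    omega
  obtain ⟨α, hα, hα'⟩ := exists_perm_eq_below (n := p) (fun x => σ x - q)
    (fun x hx => by have := hA x hx; omega)
    (fun x hx y hy hxy => by
      have := hA x hx
      have := hA y hy
      exact σ.injective (by omega))
  obtain ⟨β, hβ, hβ'⟩ := exists_perm_eq_below (n := q) (fun x => σ (x + p))
    (fun x hx => hB x hx)
    (fun x hx y hy hxy => by have := σ.injective hxy; omega)
  refine ⟨α, β, ⟨hα, fun x hx => ?_, altBelow_inv_iff.2 fun x y hxy hy => ?_,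
    fun i j l k _ h2 h3 h4 h5 => ?_⟩, ⟨hβ, fun x hx => ?_,
    altBelow_inv_iff.2 fun x y hxy hy => ?_, fun i j l k _ h2 h3 h4 h5 => ?_⟩, ?_⟩
  · rw [hα' x (by omega), hα' _ hx]
    have := h.alt x (by omega)
    have := hA x (by omega)
    have := hA _ hx
    omega
  · have hx' := hα.apply_lt_iff.1 (show α x < p by omega)
    have hy' := hα.apply_lt_iff.1 hy
    rw [hα' x hx'] at hxy ⊢
    rw [hα' y hy'] at hxy hy
    have := altBelow_inv_iff.1 h.alt_inv x y
    have := hA x hx'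
    have := hA y hy'
    omega
  · have := h.sep i j l k (by omega) h2 h3 h4 (by omega)
    unfold AvoidsAt at this ⊢
    rw [hα' i (by omega), hα' j (by omega), hα' l (by omega), hα' k (by omega)]
    have := hA i (by omega)
    have := hA j (by omega)
    have := hA l (by omega)
    have := hA k (by omega)
    omega
  · rw [hβ' x (by omega), hβ' _ hx]
    have := h.alt (x + p) (by omega)
    rw [show x + p + 1 = x + 1 + p by omega] at this
    omega
  · have hx' := hβ.apply_lt_iff.1 (show β x < q by omega)
    have hy' := hβ.apply_lt_iff.1 hy
    rw [hβ' x hx'] at hxy ⊢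
    rw [hβ' y hy'] at hxy hy
    have := altBelow_inv_iff.1 h.alt_inv (x + p) (y + p)
    omega
  · have := h.sep (i + p) (j + p) (l + p) (k + p) (by omega) (by omega) (by omega) (by omega)
      (by omega)
    unfold AvoidsAt at this ⊢
    rwa [hβ' i (by omega), hβ' j (by omega), hβ' l (by omega), hβ' k (by omega)]
  · ext x
    rcases lt_or_ge x (p + q) with hx | hx
    · rcases lt_or_ge x p with hxp | hxp
      · rw [skewSum_apply_of_lt hα hxp, hα' x hxp]
        have := hA x hxp
        omega
      · rw [skewSum_apply_of_le hα hβ hxp hx, hβ' _ (by omega), Nat.sub_add_cancel hxp]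
    · rw [h.supp x hx, suppBelow_skewSum hα hβ x hx]

/-! ### Reversing and adding a first minimum and a last maximum -/

/-- The direct sum `1 ⊕ τʳ ⊕ 1`, where `τʳ` is the reversal of `τ`, a permutation of size `n`: the
value at `0` is `0`, the value at `x ∈ [1, n]` is `τ (n - x) + 1`, and `n + 1` is fixed. -/
def wrapReverse (n : ℕ) (τ : Equiv.Perm ℕ) : Equiv.Perm ℕ :=
  blockSwap n 1 * τ * revBelow (n + 1)

section wrapReverse
variable {n : ℕ} {τ : Equiv.Perm ℕ}

theorem wrapReverse_zero (h : SuppBelow n τ) : wrapReverse n τ 0 = 0 := by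
  simp only [wrapReverse, Equiv.Perm.mul_apply, revBelow_apply]
  rw [if_pos (by omega), h _ (by omega), blockSwap_apply, if_neg (by omega), if_pos (by omega)]
  omega

theorem wrapReverse_apply (h : SuppBelow n τ) {x : ℕ} (hx : 0 < x) (hx' : x ≤ n) :
    wrapReverse n τ x = τ (n - x) + 1 := by
  have := h.apply_lt_iff.2 (show n - x < n by omega)
  simp only [wrapReverse, Equiv.Perm.mul_apply, revBelow_apply]
  rw [if_pos (by omega), show n + 1 - 1 - x = n - x by omega, blockSwap_apply, if_pos this]

theorem wrapReverse_of_lt (h : SuppBelow n τ) {x : ℕ} (hx : n < x) : wrapReverse n τ x = x := by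
  simp only [wrapReverse, Equiv.Perm.mul_apply, revBelow_apply]
  rw [if_neg (by omega), h x (by omega), blockSwap_apply, if_neg (by omega), if_neg (by omega)]

theorem suppBelow_wrapReverse (h : SuppBelow n τ) : SuppBelow (n + 2) (wrapReverse n τ) :=
  fun _ hx => wrapReverse_of_lt h (by omega)

theorem wrapReverse_cases (h : SuppBelow n τ) {x : ℕ} (hx : x < n + 2) :
    (x = 0 ∧ wrapReverse n τ x = 0) ∨
      (0 < x ∧ x ≤ n ∧ wrapReverse n τ x = τ (n - x) + 1 ∧ τ (n - x) < n) ∨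
      (x = n + 1 ∧ wrapReverse n τ x = n + 1) := by
  rcases Nat.eq_zero_or_pos x with rfl | h0
  · exact Or.inl ⟨rfl, wrapReverse_zero h⟩
  · rcases Nat.lt_or_ge n x with h1 | h1
    · obtain rfl : x = n + 1 := by omega
      exact Or.inr (Or.inr ⟨rfl, wrapReverse_of_lt h h1⟩)
    · exact Or.inr (Or.inl ⟨h0, h1, wrapReverse_apply h h0 h1, h.apply_lt_iff.2 (by omega)⟩)

theorem isDab_wrapReverse (hn : n % 2 = 0) (h : IsDab n τ) :
    IsDab (n + 2) (wrapReverse n τ) := by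
  have hS := suppBelow_wrapReverse h.supp
  refine ⟨hS, fun x hx => ?_, altBelow_inv_iff.2 fun x y hxy hy => ?_,
    fun i j l k _ h2 h3 h4 h5 => ?_⟩
  · have hA := h.alt (n - (x + 1))
    rcases wrapReverse_cases h.supp (show x < n + 2 by omega) with c | c | c <;>
    rcases wrapReverse_cases h.supp hx with d | d | d
    all_goals try omega
    rw [show n - (x + 1) + 1 = n - x by omega] at hA
    omega
  · have hx' := hS.apply_lt_iff.1 (show wrapReverse n τ x < n + 2 by omega)
    have hy' := hS.apply_lt_iff.1 hy
    have hA := altBelow_inv_iff.1 h.alt_inv (n - x) (n - y)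
    rcases wrapReverse_cases h.supp hx' with c | c | c <;>
    rcases wrapReverse_cases h.supp hy' with d | d | d <;>
    omega
  · have hA := h.sep (n - k) (n - l) (n - j) (n - i)
    unfold AvoidsAt at hA ⊢
    have bj := h.supp.apply_lt_iff.2 (show n - j < n by omega)
    have bl := h.supp.apply_lt_iff.2 (show n - l < n by omega)
    rw [wrapReverse_apply h.supp (show 0 < j by omega) (by omega),
      wrapReverse_apply h.supp (show 0 < l by omega) (by omega)]
    rcases wrapReverse_cases h.supp (show i < n + 2 by omega) with c | c | c <;>
    rcases wrapReverse_cases h.supp (show k < n + 2 by omega) with d | d | d <;>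
    omega

theorem wrapReverse_inj {τ' : Equiv.Perm ℕ} (h : wrapReverse n τ = wrapReverse n τ') : τ = τ' :=
  mul_left_cancel (mul_right_cancel h)

end wrapReverse

theorem IsDab.exists_wrapReverse {n : ℕ} {σ : Equiv.Perm ℕ} (hn : n % 2 = 0)
    (h : IsDab (n + 2) σ) (h0 : σ 0 = 0) (h1 : σ (n + 1) = n + 1) :
    ∃ τ, IsDab n τ ∧ σ = wrapReverse n τ := by
  have hA : ∀ x < n, 0 < σ (n - x) ∧ σ (n - x) ≤ n := fun x hx => by
    have n0 : σ (n - x) ≠ σ 0 := σ.injective.ne (by omega)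
    have n1 : σ (n - x) ≠ σ (n + 1) := σ.injective.ne (by omega)
    have := h.supp.apply_lt_iff.2 (show n - x < n + 2 by omega)
    omega
  obtain ⟨τ, hτ, hτ'⟩ := exists_perm_eq_below (n := n) (fun x => σ (n - x) - 1)
    (fun x hx => by have := hA x hx; omega)
    (fun x hx y hy hxy => by
      have := hA x hx
      have := hA y hy
      have := σ.injective (show σ (n - x) = σ (n - y) by omega)
      omega)
  refine ⟨τ, ⟨hτ, fun x hx => ?_, altBelow_inv_iff.2 fun x y hxy hy => ?_,
    fun i j l k _ h2 h3 h4 h5 => ?_⟩, ?_⟩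
  · rw [hτ' x (by omega), hτ' _ hx]
    have := h.alt (n - (x + 1)) (by omega)
    rw [show n - (x + 1) + 1 = n - x by omega] at this
    have := hA x (by omega)
    have := hA _ hx
    omega
  · have hx' := hτ.apply_lt_iff.1 (show τ x < n by omega)
    have hy' := hτ.apply_lt_iff.1 hy
    rw [hτ' x hx'] at hxy ⊢
    rw [hτ' y hy'] at hxy hy
    have := altBelow_inv_iff.1 h.alt_inv (n - x) (n - y)
    have := hA x hx'
    have := hA y hy'
    omega
  · have := h.sep (n - k) (n - l) (n - j) (n - i) (by omega) (by omega) (by omega) (by omega)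
      (by omega)
    unfold AvoidsAt at this ⊢
    rw [hτ' i (by omega), hτ' j (by omega), hτ' l (by omega), hτ' k (by omega)]
    have := hA i (by omega)
    have := hA j (by omega)
    have := hA l (by omega)
    have := hA k (by omega)
    omega
  · ext x
    rcases lt_or_ge x (n + 2) with hx | hx
    · rcases wrapReverse_cases hτ hx with ⟨rfl, c⟩ | ⟨c0, c1, c2, c3⟩ | ⟨rfl, c⟩
      · rw [c, h0]
      · rw [c2, hτ' _ (by omega), show n - (n - x) = x by omega]
        have := hA (n - x) (by omega)
        rw [show n - (n - x) = x by omega] at this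
        omega
      · rw [c, h1]
    · rw [h.supp x hx, suppBelow_wrapReverse hτ x hx]

/-! ### The decomposition -/

/-- If the first value is below the last one, the first value is `0`. Otherwise cut at the last
position with a value below the first one, and cut the lower part again at the last position with a
value above the first one. The final piece of the lower part starts at an even position, ends at an
even position, so has odd length and even top value `r - t - 1`; but the next value `r - t` stands
to its left, which alternation of the inverse forbids. -/
theorem IsDab.apply_zero_of_lt {n : ℕ} {σ : Equiv.Perm ℕ} (hn : 0 < n) (h : IsDab n σ)
    (hlt : σ 0 < σ (n - 1)) : σ 0 = 0 := by
  obtain ⟨r, hr0, hrn, hr, hw1, hw2⟩ := h.supp.isWindow.split_up hn (by simpa using h.sep)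
    (by simpa using hlt)
  simp only [Nat.zero_add] at hr hw1 hw2
  rcases Nat.eq_or_lt_of_le (show 1 ≤ r by omega) with rfl | hr1
  · have := (hw1 0).1 (by omega)
    omega
  have hne : σ (r - 1) ≠ σ 0 := σ.injective.ne (by omega)
  obtain ⟨t, ht0, htr, ht, hv1, hv2⟩ := hw1.split_down hr0 (h.sep.mono (by omega) (by omega))
    (by rw [Nat.zero_add]; omega)
  simp only [Nat.zero_add] at ht hv1 hv2
  have a1 := h.alt (r - 1) (by omega)
  have a2 := h.alt (t - 1) (by omega)
  rw [show r - 1 + 1 = r by omega] at a1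
  rw [show t - 1 + 1 = t by omega] at a2
  have b1 := (hw2 r).1 (by omega)
  have b2 := (hw1 (r - 1)).1 (by omega)
  have b3 := (hv2 t).1 (by omega)
  have b4 := (hv1 (t - 1)).1 (by omega)
  obtain ⟨x, hx, hx1, hx2⟩ := hv2.exists_pos (w := r - t - 1) (by omega) (by omega)
  obtain ⟨y, hy, hy1, hy2⟩ := hv1.exists_pos (w := r - t) (by omega) (by omega)
  have := altBelow_inv_iff.1 h.alt_inv x y (by omega) (by omega)
  omega

theorem IsDab.apply_last_of_lt {n : ℕ} {σ : Equiv.Perm ℕ} (hn : 0 < n) (hn2 : n % 2 = 0)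
    (h : IsDab n σ) (hlt : σ 0 < σ (n - 1)) : σ (n - 1) = n - 1 := by
  have hb := h.supp.apply_lt_iff.2 (show n - 1 < n by omega)
  have h1 := revComp_apply h.supp (show 0 < n by omega)
  have h2 := revComp_apply h.supp (show n - 1 < n by omega)
  rw [Nat.sub_zero] at h1
  rw [Nat.sub_self] at h2
  have := (h.revComp hn2).apply_zero_of_lt hn (by omega)
  omega

/-- The decomposition behind the Catalan recursion. If the first value is above the last one, the
permutation is cut after the last position with a value above the first one; the first part then
has its first value below its last one. -/
theorem IsDab.exists_eq_skewSum_wrapReverse {n : ℕ} {σ : Equiv.Perm ℕ} (hn : 0 < n)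
    (hn2 : n % 2 = 0) (h : IsDab n σ) :
    ∃ a b τ β, 2 * a + 2 + 2 * b = n ∧ IsDab (2 * a) τ ∧ IsDab (2 * b) β ∧
      σ = skewSum (2 * a + 2) (2 * b) (wrapReverse (2 * a) τ) β := by
  obtain ⟨a, b, α, β, hab, hα, hβ, rfl, hlt⟩ : ∃ a b α β, 2 * a + 2 + 2 * b = n ∧
      IsDab (2 * a + 2) α ∧ IsDab (2 * b) β ∧ σ = skewSum (2 * a + 2) (2 * b) α β ∧
      α 0 < α (2 * a + 1) := by
    have hne : σ 0 ≠ σ (n - 1) := σ.injective.ne (by omega)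
    rcases lt_or_gt_of_ne hne with hlt | hlt
    · obtain ⟨a, rfl⟩ : ∃ a, n = 2 * a + 2 := ⟨n / 2 - 1, by omega⟩
      obtain ⟨α, β, hα, hβ, rfl⟩ := IsDab.exists_skewSum (q := 2 * 0) hn2 (by omega)
        (by simpa using h) (by simpa using h.supp.isWindow)
      refine ⟨a, 0, α, β, by omega, hα, hβ, rfl, ?_⟩
      rw [skewSum_apply_of_lt hα.supp (by omega), skewSum_apply_of_lt hα.supp (by omega)] at hlt
      simpa using hlt
    · obtain ⟨r, hr0, hrn, hr, hw1, hw2⟩ := h.supp.isWindow.split_down hn (by simpa using h.sep)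
        (by simpa using hlt)
      simp only [Nat.zero_add] at hr hw1 hw2
      have a1 := h.alt (r - 1) (by omega)
      rw [show r - 1 + 1 = r by omega] at a1
      have b1 := (hw2 r).1 (by omega)
      have b2 := (hw1 (r - 1)).1 (by omega)
      obtain ⟨a, rfl⟩ : ∃ a, r = 2 * a + 2 := ⟨r / 2 - 1, by omega⟩
      obtain ⟨b, rfl⟩ : ∃ b, n = 2 * a + 2 + 2 * b := ⟨(n - (2 * a + 2)) / 2, by omega⟩
      rw [show 2 * a + 2 + 2 * b - (2 * a + 2) = 2 * b by omega] at hw1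
      obtain ⟨α, β, hα, hβ, rfl⟩ := h.exists_skewSum (by omega) (by omega) hw1
      refine ⟨a, b, α, β, rfl, hα, hβ, rfl, ?_⟩
      have hne : α 0 ≠ α (2 * a + 1) := α.injective.ne (by omega)
      rw [skewSum_apply_of_lt hα.supp (by omega), skewSum_apply_of_lt hα.supp (by omega),
        show 2 * a + 2 - 1 = 2 * a + 1 by omega] at hr
      omega
  obtain ⟨τ, hτ, rfl⟩ := hα.exists_wrapReverse (by omega)
    (hα.apply_zero_of_lt (by omega) hlt) (hα.apply_last_of_lt (by omega) (by omega) hlt)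
  exact ⟨a, b, τ, β, hab, hτ, hβ, rfl⟩

/-! ### Passage from permutations of `Fin n` to permutations of `ℕ` -/

/-- A permutation of `Fin n` as a permutation of `ℕ` fixing all `x ≥ n`. -/
noncomputable def extendNat {n : ℕ} (σ : Equiv.Perm (Fin n)) : Equiv.Perm ℕ :=
  Equiv.Perm.viaEmbeddingHom Fin.valEmbedding σ

section extendNat
variable {n : ℕ}

theorem extendNat_injective : Function.Injective (extendNat (n := n)) :=
  Equiv.Perm.viaEmbeddingHom_injective _

theorem extendNat_inv (σ : Equiv.Perm (Fin n)) : extendNat σ⁻¹ = (extendNat σ)⁻¹ :=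
  map_inv _ σ

theorem extendNat_apply (σ : Equiv.Perm (Fin n)) (x : Fin n) : extendNat σ x = σ x :=
  σ.viaEmbedding_apply Fin.valEmbedding x

theorem suppBelow_extendNat (σ : Equiv.Perm (Fin n)) : SuppBelow n (extendNat σ) := by
  intro x hx
  refine σ.viaEmbedding_apply_of_notMem Fin.valEmbedding x ?_
  rintro ⟨y, rfl⟩
  simp only [Fin.valEmbedding_apply] at hx
  omega

theorem exists_extendNat_eq {s : Equiv.Perm ℕ} (h : SuppBelow n s) :
    ∃ σ : Equiv.Perm (Fin n), extendNat σ = s := by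
  let f : Fin n → Fin n := fun x => ⟨s x, h.apply_lt_iff.2 x.2⟩
  have hf : Function.Injective f := fun x y hxy =>
    Fin.ext (s.injective (by simpa [f] using hxy))
  refine ⟨Equiv.ofBijective f (Finite.injective_iff_bijective.1 hf), ?_⟩
  ext x
  rcases lt_or_ge x n with hx | hx
  · exact extendNat_apply _ ⟨x, hx⟩
  · rw [suppBelow_extendNat _ x hx, h x hx]

theorem altBelow_extendNat_iff {σ : Equiv.Perm (Fin n)} :
    AltBelow n (extendNat σ) ↔ IsAlternating σ := by
  constructor
  · intro h p q hpq
    have := h p (by omega)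
    rw [hpq, extendNat_apply, extendNat_apply] at this
    simpa only [Fin.lt_def, Nat.even_iff, Nat.mod_two_ne_zero] using this
  · intro h p hp
    have := h ⟨p, by omega⟩ ⟨p + 1, hp⟩ rfl
    rw [Fin.lt_def, Fin.lt_def, ← extendNat_apply, ← extendNat_apply] at this
    simpa only [Nat.even_iff, Nat.mod_two_ne_zero] using this

/-- Positions `x ≥ n` are fixed and cannot take part in a forbidden pattern. -/
theorem baxterNat_extendNat {σ : Equiv.Perm (Fin n)} (h : IsBaxter σ) :
    BaxterNat (extendNat σ) := by
  intro i j k hij hjk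
  have hs := suppBelow_extendNat σ
  by_cases hk : k < n
  · have := h ⟨i, by omega⟩ ⟨j, by omega⟩ ⟨j + 1, by omega⟩ ⟨k, hk⟩ hij
      (Fin.lt_def.2 (by simpa using Nat.lt_of_succ_lt hjk)) rfl
    simpa only [AvoidsAt, Fin.lt_def, ← extendNat_apply] using this
  · have h1 := hs.apply_lt_iff (x := i)
    have h2 := hs.apply_lt_iff (x := j)
    have h3 := hs.apply_lt_iff (x := j + 1)
    have h4 := hs k (by omega)
    have h5 := hs i
    have h6 := hs j
    have h7 := hs (j + 1)
    unfold AvoidsAt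
    omega

theorem isDab_extendNat_iff {σ : Equiv.Perm (Fin n)} :
    IsDab n (extendNat σ) ↔ IsDoublyAlternatingBaxter σ := by
  constructor
  · intro h
    refine ⟨fun i j j' k hij hjk hj => ?_, altBelow_extendNat_iff.1 h.alt,
      altBelow_extendNat_iff.1 (by rw [extendNat_inv]; exact h.alt_inv)⟩
    rw [Fin.lt_def] at hij hjk
    rcases Nat.eq_or_lt_of_le (show j'.val ≤ k.val by omega) with hk | hk
    · obtain rfl : j' = k := Fin.ext hk
      simp only [Fin.lt_def]
      omega
    · have := h.sep i j j' k (by omega) hij (by omega) hk k.2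
      simpa only [AvoidsAt, extendNat_apply, ← Fin.lt_def] using this
  · rintro ⟨hB, hA, hA'⟩
    have h1 := altBelow_extendNat_iff.2 hA
    have h2 := altBelow_extendNat_iff.2 hA'
    rw [extendNat_inv] at h2
    exact ⟨suppBelow_extendNat σ, h1, h2,
      (baxterNat_extendNat hB).sepOn (suppBelow_extendNat σ) h1 h2⟩

end extendNat

/-- The doubly alternating Baxter permutations of size `n`, as permutations of `ℕ`. -/
noncomputable def dabNat (n : ℕ) : Finset (Equiv.Perm ℕ) :=
  (doublyAlternatingBaxter n).map ⟨extendNat, extendNat_injective⟩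

theorem mem_dabNat {n : ℕ} {s : Equiv.Perm ℕ} : s ∈ dabNat n ↔ IsDab n s := by
  simp only [dabNat, Finset.mem_map, Function.Embedding.coeFn_mk, doublyAlternatingBaxter,
    Finset.mem_filter_univ]
  constructor
  · rintro ⟨σ, hσ, rfl⟩
    exact isDab_extendNat_iff.2 hσ
  · intro h
    obtain ⟨σ, rfl⟩ := exists_extendNat_eq h.supp
    exact ⟨σ, isDab_extendNat_iff.1 h, rfl⟩

theorem card_dabNat (n : ℕ) : (dabNat n).card = (doublyAlternatingBaxter n).card :=
  Finset.card_map _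

theorem dabCount_eq_card_filter {m i j : ℕ} (hi : 1 ≤ i) (hi' : i ≤ 2 * m) (hj : 1 ≤ j) :
    dabCount m i j = ((dabNat (2 * m)).filter fun s => s (i - 1) = j - 1).card := by
  rw [dabNat, Finset.filter_map, Finset.card_map, dabCount]
  congr 1
  refine Finset.filter_congr fun σ _ => ?_
  have hx := extendNat_apply σ ⟨i - 1, by omega⟩
  simp only [Function.comp_apply, Function.Embedding.coeFn_mk]
  rw [hx]
  constructor
  · rintro ⟨p, hp, hpj⟩
    have hp' : p = ⟨i - 1, by omega⟩ := Fin.ext (by dsimp only; omega)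
    rw [← hp']
    omega
  · intro h
    exact ⟨⟨i - 1, by omega⟩, by dsimp only; omega, by omega⟩

theorem dabCount_comm {m i j : ℕ} (hi : 1 ≤ i) (hi' : i ≤ 2 * m) (hj : 1 ≤ j) (hj' : j ≤ 2 * m) :
    dabCount m i j = dabCount m j i := by
  rw [dabCount_eq_card_filter hi hi' hj, dabCount_eq_card_filter hj hj' hi]
  refine Finset.card_bij' (fun s _ => s⁻¹) (fun s _ => s⁻¹) ?_ ?_ (fun s _ => inv_inv s)
    (fun s _ => inv_inv s) <;>
  · intro s hs
    simp only [Finset.mem_filter, mem_dabNat] at hs ⊢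
    exact ⟨hs.1.inv, by rw [Equiv.Perm.inv_eq_iff_eq, hs.2]⟩

theorem dabCount_revComp {m i j : ℕ} (hi : 1 ≤ i) (hi' : i ≤ 2 * m) (hj : 1 ≤ j)
    (hj' : j ≤ 2 * m) : dabCount m i j = dabCount m (2 * m + 1 - i) (2 * m + 1 - j) := by
  rw [dabCount_eq_card_filter hi hi' hj,
    dabCount_eq_card_filter (by omega) (by omega) (by omega)]
  refine Finset.card_bij' (fun s _ => revComp (2 * m) s) (fun s _ => revComp (2 * m) s) ?_ ?_
    (fun s _ => revComp_revComp _ s) (fun s _ => revComp_revComp _ s) <;>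
  · intro s hs
    simp only [Finset.mem_filter, mem_dabNat] at hs ⊢
    refine ⟨hs.1.revComp (by omega), ?_⟩
    rw [revComp_apply hs.1.supp (by omega)]
    first
    | rw [show 2 * m - 1 - (2 * m + 1 - i - 1) = i - 1 by omega]; omega
    | rw [show 2 * m - 1 - (i - 1) = 2 * m + 1 - i - 1 by omega]; omega

/-! ### Catalan numbers -/

/-- The permutation `(1 ⊕ τʳ ⊕ 1) ⊖ β` of size `2 (a + b + 1)` made from `τ` of size `2 a` and `β`
of size `2 b`, where `t = (τ, β)`. -/
noncomputable def dabGlue (a b : ℕ) (t : Equiv.Perm ℕ × Equiv.Perm ℕ) : Equiv.Perm ℕ :=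
  skewSum (2 * a + 2) (2 * b) (wrapReverse (2 * a) t.1) t.2

theorem dabGlue_zero {a b : ℕ} {t : Equiv.Perm ℕ × Equiv.Perm ℕ} (h : IsDab (2 * a) t.1) :
    dabGlue a b t 0 = 2 * b := by
  rw [dabGlue, skewSum_apply_of_lt (suppBelow_wrapReverse h.supp) (by omega),
    wrapReverse_zero h.supp, Nat.zero_add]

/-- Doubly alternating Baxter permutations of size `2 (m + 1)` correspond to pairs of such
permutations of sizes `2 a` and `2 b` with `a + b = m`. -/
theorem card_filter_dabNat_succ (m : ℕ) (P : Equiv.Perm ℕ → Prop) [DecidablePred P] :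
    ((dabNat (2 * (m + 1))).filter P).card =
      ∑ ab ∈ Finset.HasAntidiagonal.antidiagonal m,
        ((dabNat (2 * ab.1) ×ˢ dabNat (2 * ab.2)).filter fun t =>
          P (dabGlue ab.1 ab.2 t)).card := by
  rw [← Finset.card_sigma]
  symm
  refine Finset.card_bij (fun x _ => dabGlue x.1.1 x.1.2 x.2) ?_ ?_ ?_
  · rintro ⟨⟨a, b⟩, t⟩ h
    simp only [Finset.mem_sigma, Finset.HasAntidiagonal.mem_antidiagonal,
      Finset.mem_filter, Finset.mem_product, mem_dabNat] at h ⊢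
    obtain ⟨rfl, ⟨h1, h2⟩, h3⟩ := h
    refine ⟨?_, h3⟩
    rw [show 2 * (a + b + 1) = 2 * a + 2 + 2 * b by ring]
    exact isDab_skewSum (by omega) (by omega) (isDab_wrapReverse (by omega) h1) h2
  · rintro ⟨⟨a, b⟩, t⟩ h ⟨⟨a', b'⟩, t'⟩ h' heq
    simp only [Finset.mem_sigma, Finset.HasAntidiagonal.mem_antidiagonal,
      Finset.mem_filter, Finset.mem_product, mem_dabNat] at h h' heq
    obtain ⟨hab, ⟨h1, h2⟩, -⟩ := h
    obtain ⟨hab', ⟨h1', h2'⟩, -⟩ := h'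
    -- The value at `0` determines the size of the second part.
    have h0 := congrArg (· 0) heq
    simp only [dabGlue_zero h1, dabGlue_zero h1'] at h0
    obtain rfl : b = b' := by omega
    obtain rfl : a = a' := by omega
    obtain ⟨e1, e2⟩ := skewSum_inj (suppBelow_wrapReverse h1.supp) h2.supp
      (suppBelow_wrapReverse h1'.supp) h2'.supp heq
    rw [Prod.ext (wrapReverse_inj e1) e2]
  · intro s hs
    simp only [Finset.mem_filter, mem_dabNat] at hs
    obtain ⟨a, b, τ, β, hab, hτ, hβ, rfl⟩ :=
      hs.1.exists_eq_skewSum_wrapReverse (by omega) (by omega)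
    refine ⟨⟨(a, b), (τ, β)⟩, ?_, rfl⟩
    simp only [Finset.mem_sigma, Finset.HasAntidiagonal.mem_antidiagonal,
      Finset.mem_filter, Finset.mem_product, mem_dabNat]
    exact ⟨by omega, ⟨hτ, hβ⟩, hs.2⟩

theorem card_dabNat_two_mul (m : ℕ) : (dabNat (2 * m)).card = catalan m := by
  induction m using Nat.strong_induction_on with
  | _ m ih =>
    rcases m with _ | m
    · rw [catalan_zero, Finset.card_eq_one]
      refine ⟨1, Finset.eq_singleton_iff_unique_mem.2
        ⟨mem_dabNat.2 (isDab_zero fun x _ => rfl), ?_⟩⟩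
      intro s hs
      ext x
      exact (mem_dabNat.1 hs).supp x (by omega)
    · have := card_filter_dabNat_succ m fun _ => True
      simp only [Finset.filter_true, Finset.card_product] at this
      rw [this, catalan_succ']
      refine Finset.sum_congr rfl fun ab hab => ?_
      rw [Finset.HasAntidiagonal.mem_antidiagonal] at hab
      rw [ih _ (by omega), ih _ (by omega)]

theorem card_doublyAlternatingBaxter (m : ℕ) :
    (doublyAlternatingBaxter (2 * m)).card = catalan m := by
  rw [← card_dabNat, card_dabNat_two_mul]

theorem card_filter_dabGlue_of_forall {a b : ℕ} {P : Equiv.Perm ℕ → Prop} [DecidablePred P]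
    (h : ∀ t : Equiv.Perm ℕ × Equiv.Perm ℕ, IsDab (2 * a) t.1 → IsDab (2 * b) t.2 →
      P (dabGlue a b t)) :
    ((dabNat (2 * a) ×ˢ dabNat (2 * b)).filter fun t => P (dabGlue a b t)).card =
      catalan a * catalan b := by
  rw [Finset.filter_true_of_mem, Finset.card_product, card_dabNat_two_mul, card_dabNat_two_mul]
  intro t ht
  simp only [Finset.mem_product, mem_dabNat] at ht
  exact h t ht.1 ht.2

/-- The value at the first position is the size of the second part of the decomposition. -/
theorem dabCount_one {m b : ℕ} (hb : b ≤ m) :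
    dabCount (m + 1) 1 (2 * b + 1) = catalan (m - b) * catalan b := by
  rw [dabCount_eq_card_filter le_rfl (by omega) (by omega), card_filter_dabNat_succ,
    Finset.sum_eq_single (m - b, b)]
  · refine card_filter_dabGlue_of_forall (P := fun s => s (1 - 1) = 2 * b + 1 - 1) fun t h _ => ?_
    rw [Nat.sub_self, dabGlue_zero h, Nat.add_sub_cancel]
  · rintro ⟨a', b'⟩ hab hne
    rw [Finset.card_eq_zero, Finset.filter_eq_empty_iff]
    intro t ht hP
    simp only [Finset.HasAntidiagonal.mem_antidiagonal, Finset.mem_product, mem_dabNat] at hab ht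
    rw [Nat.sub_self, dabGlue_zero ht.1] at hP
    exact hne (Prod.ext (by dsimp only; omega) (by dsimp only; omega))
  · intro h
    exact absurd (Finset.HasAntidiagonal.mem_antidiagonal.2 (Nat.sub_add_cancel hb)) h

theorem dabCount_one_one (m : ℕ) : dabCount (m + 1) 1 1 = catalan m := by
  simpa using dabCount_one (m := m) (b := 0) (by omega)

theorem dabCount_one_two_mul_sub_one (m : ℕ) :
    dabCount (m + 1) 1 (2 * (m + 1) - 1) = catalan m := by
  rw [show 2 * (m + 1) - 1 = 2 * m + 1 by omega]
  simpa using dabCount_one (m := m) (b := m) le_rfl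

theorem dabGlue_one {a b : ℕ} {t : Equiv.Perm ℕ × Equiv.Perm ℕ} (h : IsDab (2 * (a + 1)) t.1) :
    dabGlue (a + 1) b t 1 = 2 * b + 1 + t.1 (2 * (a + 1) - 1) := by
  rw [dabGlue, skewSum_apply_of_lt (suppBelow_wrapReverse h.supp) (by omega),
    wrapReverse_apply h.supp (by omega) (by omega)]
  omega

theorem dabGlue_zero_left_one {b : ℕ} {t : Equiv.Perm ℕ × Equiv.Perm ℕ} (h : IsDab (2 * 0) t.1) :
    dabGlue 0 b t 1 = 2 * b + 1 := by
  rw [dabGlue, skewSum_apply_of_lt (suppBelow_wrapReverse h.supp) (by omega),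
    wrapReverse_of_lt h.supp (by omega)]
  omega

theorem card_filter_last_eq (a : ℕ) :
    ((dabNat (2 * (a + 1))).filter fun s =>
      s (2 * (a + 1) - 1) = 2 * (a + 1) - 1).card = catalan a := by
  rw [← dabCount_eq_card_filter (by omega) le_rfl (by omega),
    dabCount_revComp (by omega) le_rfl (by omega) le_rfl, ← dabCount_one_one a]
  congr 1 <;> omega

/-- In `(1 ⊕ τʳ ⊕ 1) ⊖ β` the second position carries the second highest value exactly if `τ` is not
empty and ends with its maximum. There are `catalan (a - 1)` such `τ` of size `2 a`, and summing
over `a` gives the Catalan recursion again. -/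
theorem dabCount_two_two_mul_sub_one (m : ℕ) :
    dabCount (m + 2) 2 (2 * (m + 2) - 1) = catalan (m + 1) := by
  rw [dabCount_eq_card_filter (by omega) (by omega) (by omega), card_filter_dabNat_succ (m + 1),
    Finset.Nat.sum_antidiagonal_succ, catalan_succ']
  rw [Finset.card_eq_zero.2, zero_add]
  · refine Finset.sum_congr rfl fun ab hab => ?_
    obtain ⟨a, b⟩ := ab
    simp only [Finset.HasAntidiagonal.mem_antidiagonal] at hab
    rw [← card_filter_last_eq a, ← card_dabNat_two_mul b, ← Finset.card_product,
      ← Finset.filter_product_left]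
    congr 1
    refine Finset.filter_congr fun t ht => ?_
    simp only [Finset.mem_product, mem_dabNat] at ht
    rw [dabGlue_one ht.1]
    omega
  · rw [Finset.filter_eq_empty_iff]
    intro t ht
    simp only [Finset.mem_product, mem_dabNat] at ht
    rw [dabGlue_zero_left_one ht.1]
    omega

/-! ### Limits -/

theorem add_two_mul_catalan_succ (n : ℕ) :
    (n + 2) * catalan (n + 1) = 2 * (2 * n + 1) * catalan n := by
  have h1 := succ_mul_catalan_eq_centralBinom n
  have h2 := succ_mul_catalan_eq_centralBinom (n + 1)
  have h3 := Nat.succ_mul_centralBinom_succ n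
  rw [← h1, ← h2] at h3
  refine Nat.eq_of_mul_eq_mul_left (Nat.succ_pos n) ?_
  rw [Nat.succ_eq_add_one, h3]
  ring

theorem catalan_pos (n : ℕ) : 0 < catalan n := by
  have h1 := succ_mul_catalan_eq_centralBinom n
  have h2 := Nat.centralBinom_pos n
  rw [← h1] at h2
  exact Nat.pos_of_mul_pos_left h2

theorem tendsto_catalan_div_catalan_succ :
    Tendsto (fun n : ℕ => (catalan n : ℝ) / catalan (n + 1)) atTop (𝓝 (1 / 4)) := by
  -- The quotient is `(n + 2) / (4 n + 2)`.
  have h (n : ℕ) :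
      (catalan n : ℝ) / catalan (n + 1) = 1 / 4 + 3 / 8 * (1 / ((n : ℝ) + 1 / 2)) := by
    have h1 : ((n : ℝ) + 2) * catalan (n + 1) = 2 * (2 * n + 1) * catalan n := by
      exact_mod_cast add_two_mul_catalan_succ n
    have h2 : (0 : ℝ) < catalan (n + 1) := by exact_mod_cast catalan_pos (n + 1)
    have h3 : (n : ℝ) + 1 / 2 ≠ 0 := by positivity
    rw [div_eq_iff h2.ne']
    field_simp
    linarith
  simp only [h]
  have : Tendsto (fun n : ℕ => 1 / ((n : ℝ) + 1 / 2)) atTop (𝓝 0) := by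
    simp only [one_div]
    exact tendsto_inv_atTop_zero.comp
      (tendsto_atTop_add_const_right _ _ tendsto_natCast_atTop_atTop)
  have := (this.const_mul (3 / 8)).const_add (1 / 4)
  rwa [mul_zero, add_zero] at this

theorem tendsto_dabProb_of_dabCount_eq {i j : ℕ → ℕ}
    (h : ∀ m, dabCount (m + 2) (i (m + 2)) (j (m + 2)) = catalan (m + 1)) :
    Tendsto (fun m => dabProb m (i m) (j m)) atTop (𝓝 (1 / 4)) := by
  rw [← tendsto_add_atTop_iff_nat 2]
  refine ((tendsto_add_atTop_iff_nat 1).2 tendsto_catalan_div_catalan_succ).congr fun m => ?_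
  rw [dabProb, h, card_doublyAlternatingBaxter]

theorem tendsto_mul_atTop_of_tendsto_quarter {f : ℕ → ℝ} (h : Tendsto f atTop (𝓝 (1 / 4))) :
    Tendsto (fun m : ℕ => (m : ℝ) * f m) atTop atTop :=
  tendsto_natCast_atTop_atTop.atTop_mul_pos (by norm_num) h

theorem dabCount_eq_zero {m i j : ℕ} (hi : 1 ≤ i) (hi' : i ≤ 2 * m) (hj : 1 ≤ j)
    (h : ∀ s, IsDab (2 * m) s → s (i - 1) ≠ j - 1) : dabCount m i j = 0 := by
  rw [dabCount_eq_card_filter hi hi' hj, Finset.card_eq_zero, Finset.filter_eq_empty_iff]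
  exact fun s hs => h s (mem_dabNat.1 hs)

/-! ### Vanishing probabilities -/

theorem IsDab.apply_zero_even {n : ℕ} {s : Equiv.Perm ℕ} (hn : 0 < n) (hn2 : n % 2 = 0)
    (h : IsDab n s) : s 0 % 2 = 0 := by
  obtain ⟨a, b, τ, β, -, hτ, -, rfl⟩ := h.exists_eq_skewSum_wrapReverse hn hn2
  have := dabGlue_zero (b := b) (t := (τ, β)) hτ
  dsimp only [dabGlue] at this
  omega

theorem IsDab.apply_one_ne_one {n : ℕ} {s : Equiv.Perm ℕ} (hn : 2 < n) (h : IsDab n s) :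
    s 1 ≠ 1 := by
  intro h1
  have h2 : s 0 < s 1 := (h.alt 0 (by omega)).1 rfl
  have h3 : s⁻¹ 2 < s⁻¹ 1 := (h.alt_inv 1 hn).2 rfl
  rw [Equiv.Perm.inv_eq_iff_eq.2 h1.symm, Nat.lt_one_iff, Equiv.Perm.inv_eq_iff_eq] at h3
  omega

theorem dabCount_one_even {m j : ℕ} (hm : 1 ≤ m) (hj : 1 ≤ j) (hj2 : j % 2 = 0) :
    dabCount m 1 j = 0 := by
  refine dabCount_eq_zero le_rfl (by omega) hj fun s hs h => ?_
  have := hs.apply_zero_even (by omega) (by omega)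
  rw [Nat.sub_self] at h
  omega

theorem dabCount_antidiag {m i j : ℕ} (hi : 1 ≤ i) (hi' : i ≤ 2 * m) (hj : 1 ≤ j)
    (hj' : j ≤ 2 * m) : dabCount m i j = dabCount m (2 * m + 1 - j) (2 * m + 1 - i) := by
  rw [dabCount_revComp hi hi' hj hj', dabCount_comm] <;> omega

theorem dabProb_eq_zero {m i j : ℕ} (h : dabCount m i j = 0) : dabProb m i j = 0 := by
  rw [dabProb, h, Nat.cast_zero, zero_div]

theorem mainTheorem3 :
    (∀ m : ℕ, (doublyAlternatingBaxter (2 * m)).Nonempty) ∧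
    (∀ m i j : ℕ, 1 ≤ i → i ≤ 2 * m → 1 ≤ j → j ≤ 2 * m →
      dabProb m i j = dabProb m j i ∧
      dabProb m i j = dabProb m (2 * m + 1 - j) (2 * m + 1 - i)) ∧
    Tendsto (fun m : ℕ => dabProb m 1 1) atTop (𝓝 (1 / 4)) ∧
    Tendsto (fun m : ℕ => dabProb m 1 (2 * m - 1)) atTop (𝓝 (1 / 4)) ∧
    Tendsto (fun m : ℕ => dabProb m 2 (2 * m - 1)) atTop (𝓝 (1 / 4)) ∧
    Tendsto (fun m : ℕ => dabProb m (2 * m) (2 * m)) atTop (𝓝 (1 / 4)) ∧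
    Tendsto (fun m : ℕ => dabProb m (2 * m - 1) 1) atTop (𝓝 (1 / 4)) ∧
    Tendsto (fun m : ℕ => dabProb m 2 (2 * m)) atTop (𝓝 (1 / 4)) ∧
    Tendsto (fun m : ℕ => dabProb m (2 * m) 2) atTop (𝓝 (1 / 4)) ∧
    Tendsto (fun m : ℕ => dabProb m (2 * m - 1) 2) atTop (𝓝 (1 / 4)) ∧
    Tendsto (fun m : ℕ => (m : ℝ) * dabProb m 1 1) atTop atTop ∧
    Tendsto (fun m : ℕ => (m : ℝ) * dabProb m 1 (2 * m - 1)) atTop atTop ∧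
    Tendsto (fun m : ℕ => (m : ℝ) * dabProb m 2 (2 * m - 1)) atTop atTop ∧
    Tendsto (fun m : ℕ => (m : ℝ) * dabProb m (2 * m) (2 * m)) atTop atTop ∧
    Tendsto (fun m : ℕ => (m : ℝ) * dabProb m (2 * m - 1) 1) atTop atTop ∧
    Tendsto (fun m : ℕ => (m : ℝ) * dabProb m 2 (2 * m)) atTop atTop ∧
    Tendsto (fun m : ℕ => (m : ℝ) * dabProb m (2 * m) 2) atTop atTop ∧
    Tendsto (fun m : ℕ => (m : ℝ) * dabProb m (2 * m - 1) 2) atTop atTop ∧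
    (∀ m : ℕ, 1 ≤ m →
      dabProb m 1 2 = 0 ∧
      dabProb m 1 (2 * m) = 0 ∧
      dabProb m 2 1 = 0 ∧
      dabProb m (2 * m) 1 = 0 ∧
      dabProb m (2 * m - 1) (2 * m) = 0 ∧
      dabProb m (2 * m) (2 * m - 1) = 0) ∧
    (∀ m : ℕ, 2 ≤ m →
      dabProb m 2 2 = 0 ∧
      dabProb m (2 * m - 1) (2 * m - 1) = 0) := by
  have t1 : Tendsto (fun m : ℕ => dabProb m 1 1) atTop (𝓝 (1 / 4)) :=
    tendsto_dabProb_of_dabCount_eq fun m => dabCount_one_one (m + 1)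
  have t2 : Tendsto (fun m : ℕ => dabProb m 1 (2 * m - 1)) atTop (𝓝 (1 / 4)) :=
    tendsto_dabProb_of_dabCount_eq fun m => dabCount_one_two_mul_sub_one (m + 1)
  have t3 : Tendsto (fun m : ℕ => dabProb m 2 (2 * m - 1)) atTop (𝓝 (1 / 4)) :=
    tendsto_dabProb_of_dabCount_eq dabCount_two_two_mul_sub_one
  have t4 : Tendsto (fun m : ℕ => dabProb m (2 * m) (2 * m)) atTop (𝓝 (1 / 4)) :=
    tendsto_dabProb_of_dabCount_eq fun m => by
      rw [dabCount_antidiag (by omega) le_rfl (by omega) le_rfl, Nat.add_sub_cancel_left]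
      exact dabCount_one_one (m + 1)
  have t5 : Tendsto (fun m : ℕ => dabProb m (2 * m - 1) 1) atTop (𝓝 (1 / 4)) :=
    tendsto_dabProb_of_dabCount_eq fun m => by
      rw [dabCount_comm (by omega) (by omega) (by omega) (by omega)]
      exact dabCount_one_two_mul_sub_one (m + 1)
  have t6 : Tendsto (fun m : ℕ => dabProb m 2 (2 * m)) atTop (𝓝 (1 / 4)) :=
    tendsto_dabProb_of_dabCount_eq fun m => by
      rw [dabCount_antidiag (by omega) (by omega) (by omega) le_rfl, Nat.add_sub_cancel_left]
      exact dabCount_one_two_mul_sub_one (m + 1)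
  have t7 : Tendsto (fun m : ℕ => dabProb m (2 * m) 2) atTop (𝓝 (1 / 4)) :=
    tendsto_dabProb_of_dabCount_eq fun m => by
      rw [dabCount_comm (by omega) le_rfl (by omega) (by omega),
        dabCount_antidiag (by omega) (by omega) (by omega) le_rfl, Nat.add_sub_cancel_left]
      exact dabCount_one_two_mul_sub_one (m + 1)
  have t8 : Tendsto (fun m : ℕ => dabProb m (2 * m - 1) 2) atTop (𝓝 (1 / 4)) :=
    tendsto_dabProb_of_dabCount_eq fun m => by
      rw [dabCount_comm (by omega) (by omega) (by omega) (by omega)]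
      exact dabCount_two_two_mul_sub_one m
  refine ⟨fun m => Finset.card_pos.1 (by rw [card_doublyAlternatingBaxter]; exact catalan_pos m),
    fun m i j hi hi' hj hj' => ⟨by rw [dabProb, dabProb, dabCount_comm hi hi' hj hj'],
      by rw [dabProb, dabProb, dabCount_antidiag hi hi' hj hj']⟩, t1, t2, t3, t4, t5, t6, t7, t8,
    tendsto_mul_atTop_of_tendsto_quarter t1, tendsto_mul_atTop_of_tendsto_quarter t2,
    tendsto_mul_atTop_of_tendsto_quarter t3, tendsto_mul_atTop_of_tendsto_quarter t4,
    tendsto_mul_atTop_of_tendsto_quarter t5, tendsto_mul_atTop_of_tendsto_quarter t6,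
    tendsto_mul_atTop_of_tendsto_quarter t7, tendsto_mul_atTop_of_tendsto_quarter t8,
    fun m hm => ?_, fun m hm => ?_⟩
  · have z1 : dabCount m 1 2 = 0 := dabCount_one_even hm (by omega) rfl
    have z2 : dabCount m 1 (2 * m) = 0 := dabCount_one_even hm (by omega) (by omega)
    have z3 : dabCount m (2 * m - 1) (2 * m) = 0 := by
      rw [dabCount_antidiag (by omega) (by omega) (by omega) le_rfl, Nat.add_sub_cancel_left,
        show 2 * m + 1 - (2 * m - 1) = 2 by omega, z1]
    refine ⟨dabProb_eq_zero z1, dabProb_eq_zero z2, dabProb_eq_zero ?_, dabProb_eq_zero ?_,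
      dabProb_eq_zero z3, dabProb_eq_zero ?_⟩
    · rwa [dabCount_comm (by omega) (by omega) le_rfl (by omega)]
    · rwa [dabCount_comm (by omega) le_rfl le_rfl (by omega)]
    · rwa [dabCount_comm (by omega) le_rfl (by omega) (by omega)]
  · have z : dabCount m 2 2 = 0 :=
      dabCount_eq_zero (by omega) (by omega) (by omega) fun s hs =>
        hs.apply_one_ne_one (by omega)
    refine ⟨dabProb_eq_zero z, dabProb_eq_zero ?_⟩
    rw [dabCount_antidiag (by omega) (by omega) (by omega) (by omega),
      show 2 * m + 1 - (2 * m - 1) = 2 by omega, z]
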